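/- Let $[n]=\{1,\dots,n\}$ with $n\ge 2$, let $H(\mathbf p)=-\sum_i p_i\log_2 p_i$ be the Shannon entropy and $d_H(\mathbf p,\mathbf q)=\sqrt{\frac12\sum_i(\sqrt{p_i}-\sqrt{q_i})^2}$ the Hellinger distance. For $\epsilon\in[0,1]$ put $\mathbf p_\epsilon=(1-\epsilon,\frac{\epsilon}{n-1},\dots,\frac{\epsilon}{n-1})$ and $\tilde{\mathbf p}=(1,0,\dots,0)$. Input models for a distribution $\mathbf p$ on $[n]$: (i) the standard query oracle $|j\rangle|b\rangle\mapsto|j\rangle|b+v_j\rangle$ (labels added modulo $n$, the first label playing the role of $0$) of a string $v\in[n]^m$ with $p_i=\frac1m|\{j:v_j=i\}|$ for all $i$; (ii) the same oracle for a string $v\in[n]^m$ whose entries are drawn independently from $\mathbf p$; (iii) a unitary $U$ on $\mathbb C^n$ with $U|0\rangle=\sum_i\sqrt{p_i}|i\rangle$, where $|0\rangle$ is the first computational basis vector; (iv) a unitary $U$ on $\mathbb C^n\otimes\mathbb C^n$ with $U|0\rangle|0\rangle=\sum_i\sqrt{p_i}|\psi_i\rangle|i\rangle$ for some orthonormal $\psi_1,\dots,\psi_n$.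 A $T$-query algorithm alternates fixed unitaries on the oracle register and a finite-dimensional workspace with $T$ uses of $U$ or $U^\dagger$ (possibly controlled by the workspace), and maps the outcome of a final measurement to a real number. It succeeds on $\mathbf p$ with probability at least $s$ if it does so for every oracle representing $\mathbf p$; in model (ii) the probability is taken over $v$ as well. It distinguishes $\mathbf p_\epsilon$ from $\tilde{\mathbf p}$ if it answers $1$ on $\mathbf p_\epsilon$ and $0$ on $\tilde{\mathbf p}$, each with probability at least $s$; it is a $\gamma$-estimator if for every distribution $\mathbf p$ on $[n]$ its output lies in $[H(\mathbf p)/\gamma,\gamma H(\mathbf p)]$ with probability at least $s$ (in model (i), for every $\mathbf p$ that is the frequency vector of a string of length $m$). (a) For all $n\ge2$ and $\epsilon\in[0,1]$, $\mathbf p_\epsilon$ and $\tilde{\mathbf p}$ are distributions, $d_H(\mathbf p_\epsilon,\tilde{\mathbf p})=\sqrt{1-\sqrt{1-\epsilon}}$ and $\sqrt{\epsilon/2}\le d_H(\mathbf p_\epsilon,\tilde{\mathbf p})\le\sqrt\epsilon$. Moreover $H(\tilde{\mathbf p})=0$ and $H(\mathbf p_\epsilon)=-(1-\epsilon)\log_2(1-\epsilon)-\epsilon\log_2\epsilon+\epsilon\log_2(n-1)$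 (with $0\log_2 0=0$), which is at least $\epsilon\log_2 n$ if $\epsilon\le\frac12$ and at least $\frac\epsilon2\log_2 n$ if $n\ge3$. (b) For every $s>\frac12$ there is $c>0$, depending only on $s$, such that for all $n\ge2$ and in each of the models (i)-(iv) (for every string length $m$ in (i) and (ii)) the following holds. If $0<\epsilon\le1$ (and, in model (i), $\mathbf p_\epsilon$ is the frequency vector of some string of length $m$), then every algorithm distinguishing $\mathbf p_\epsilon$ from $\tilde{\mathbf p}$ makes at least $c/d_H(\mathbf p_\epsilon,\tilde{\mathbf p})$, in particular at least $c/\sqrt\epsilon$, queries; if moreover $\epsilon<1$, then for every $\gamma>1$ every $\gamma$-estimator makes at least $c/\sqrt\epsilon$ queries. With $\epsilon=n^{-k}$, $k>0$ real (again assumed to be representable in model (i)), both kinds of algorithms make at least $c\,n^{k/2}$ queries. (c) Consequently no algorithm making polynomially many queries estimates the entropy of all distributions on $[n]$: for every $s>\frac12$ and all real $C$ and $k>0$ there is $K$ such that for all $n\ge2$, in each of the models (i)-(iv), where in model (i) the string length is assumed to satisfy $m\ge K n^{2k+1}$, and for every $\gamma>1$, no $\gamma$-estimator makes at most $C n^k$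 queries. -/

import Mathlib

open scoped Matrix

noncomputable section

/-- The effect that one oracle query has on the query register: apply `U`, apply `U†`, or do
nothing.  In an algorithm it may be controlled by the state of the workspace. -/
inductive QueryMode where
  | forward
  | inverse
  | skip

/-- The operator on the query register that is selected by a query mode. -/
def QueryMode.op {Q : Type} [Fintype Q] [DecidableEq Q] (U : Matrix Q Q ℂ) :
    QueryMode → Matrix Q Q ℂ
  | .forward => U
  | .inverse => Uᴴ
  | .skip => 1

/-- A quantum query algorithm whose oracle acts on a register with computational basis `Q`.
The algorithm has a workspace of arbitrary finite dimension, starts in a fixed basis state, and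
alternates input-independent unitaries on query register and workspace with `queries` oracle
queries (to `U` or `U†`, possibly controlled by the workspace).  At the end all registers are
measured in the computational basis and the outcome is mapped to a real number. -/
structure QueryAlgorithm (Q : Type) [Fintype Q] [DecidableEq Q] where
  /-- dimension of the workspace -/
  workDim : ℕ
  /-- number of oracle queries -/
  queries : ℕ
  /-- initial basis state -/
  start : Q × Fin workDim
  /-- `gate t` is the unitary that is applied after the first `t` queries -/
  gate : ℕ → Matrix.unitaryGroup (Q × Fin workDim) ℂ
  /-- `mode t w` is the mode of query number `t` (counted from 0) on workspace basis state `w` -/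
  mode : ℕ → Fin workDim → QueryMode
  /-- the number returned for a given measurement outcome -/
  output : Q × Fin workDim → ℝ

namespace QueryAlgorithm

variable {Q : Type} [Fintype Q] [DecidableEq Q]

/-- The operator of query number `t`: on workspace basis state `w` it acts on the query register
as selected by `mode t w`, that is, it is the sum over `w` of `(mode t w).op U ⊗ |w⟩⟨w|`. -/
def queryMatrix (A : QueryAlgorithm Q) (U : Matrix Q Q ℂ) (t : ℕ) :
    Matrix (Q × Fin A.workDim) (Q × Fin A.workDim) ℂ :=
  Matrix.blockDiagonal fun w => (A.mode t w).op U

/-- The amplitudes of the state of the algorithm with oracle `U` after `t` queries. -/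
def state (A : QueryAlgorithm Q) (U : Matrix Q Q ℂ) : ℕ → (Q × Fin A.workDim → ℂ)
  | 0 => (A.gate 0).1 *ᵥ Pi.single A.start 1
  | t + 1 => (A.gate (t + 1)).1 *ᵥ (A.queryMatrix U t *ᵥ A.state U t)

open Classical in
/-- The probability that the algorithm, run with oracle `U`, returns a number in `S`. -/
def outputProb (A : QueryAlgorithm Q) (U : Matrix Q Q ℂ) (S : Set ℝ) : ℝ :=
  ∑ x, if A.output x ∈ S then ‖A.state U A.queries x‖ ^ 2 else 0

end QueryAlgorithm

/-- Shannon entropy (in bits) of a distribution on `n` labels. -/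
def shannonEntropy {n : ℕ} (p : Fin n → ℝ) : ℝ :=
  -∑ i, p i * Real.logb 2 (p i)

/-- Hellinger distance of two distributions on `n` labels. -/
def hellingerDist {n : ℕ} (p q : Fin n → ℝ) : ℝ :=
  √((1 / 2) * ∑ i, (√(p i) - √(q i)) ^ 2)

/-- The distribution `(1 - ε, ε / (n - 1), …, ε / (n - 1))`. -/
def hardDist (n : ℕ) [NeZero n] (ε : ℝ) : Fin n → ℝ :=
  fun i => if i = 0 then 1 - ε else ε / ((n : ℝ) - 1)

/-- The point mass `(1, 0, …, 0)`. -/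
def pointMass (n : ℕ) [NeZero n] : Fin n → ℝ :=
  Pi.single 0 1

/-- The standard query oracle of a string `v` of `m` labels, `|j⟩|b⟩ ↦ |j⟩|b + v j⟩` with addition
modulo `n`; in particular `|j⟩|0⟩ ↦ |j⟩|v j⟩`. -/
def stringOracle {m n : ℕ} (v : Fin m → Fin n) : Matrix (Fin m × Fin n) (Fin m × Fin n) ℂ :=
  Matrix.of fun x y => if x = (y.1, y.2 + v y.1) then 1 else 0

theorem stringOracle_mem_unitaryGroup {m n : ℕ} [NeZero n] (v : Fin m → Fin n) :
    stringOracle v ∈ Matrix.unitaryGroup (Fin m × Fin n) ℂ := by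
  rw [Matrix.mem_unitaryGroup_iff']
  ext x y
  have h : ((x.1, x.2 + v x.1) = (y.1, y.2 + v y.1)) ↔ x = y := by
    constructor
    · intro h
      obtain ⟨h1, h2⟩ := Prod.mk.inj h
      rw [h1] at h2
      exact Prod.ext h1 (add_right_cancel h2)
    · rintro rfl; rfl
  simp only [Matrix.star_eq_conjTranspose, Matrix.mul_apply, Matrix.conjTranspose_apply,
    stringOracle, Matrix.of_apply, apply_ite star, star_one, star_zero, ite_mul, one_mul, zero_mul,
    Finset.sum_ite_eq', Finset.mem_univ, if_true, h, Matrix.one_apply]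

/-- The relative frequencies of the labels in a string of length `m`. -/
def frequencies {m n : ℕ} (v : Fin m → Fin n) : Fin n → ℝ :=
  fun i => ((Finset.univ.filter fun j => v j = i).card : ℝ) / m

/-- The four input models for a distribution `p` on `n` labels: a query oracle to a string of
length `m` with frequency vector `p`; a query oracle to a string of `m` independent samples from
`p`; a unitary that prepares the quantum sample of `p`; purified quantum query access to `p`. -/
inductive InputModel where
  | frequency (m : ℕ)
  | samples (m : ℕ)
  | quantumSample
  | purified

namespace InputModel

/-- The computational basis of the register on which the oracle acts. -/
@[reducible] def Reg : InputModel → ℕ → Type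
  | .frequency m, n => Fin m × Fin n
  | .samples m, n => Fin m × Fin n
  | .quantumSample, n => Fin n
  | .purified, n => Fin n × Fin n

instance instFintypeReg : (M : InputModel) → (n : ℕ) → Fintype (M.Reg n)
  | .frequency m, n => inferInstanceAs (Fintype (Fin m × Fin n))
  | .samples m, n => inferInstanceAs (Fintype (Fin m × Fin n))
  | .quantumSample, n => inferInstanceAs (Fintype (Fin n))
  | .purified, n => inferInstanceAs (Fintype (Fin n × Fin n))

instance instDecidableEqReg : (M : InputModel) → (n : ℕ) → DecidableEq (M.Reg n)
  | .frequency m, n => inferInstanceAs (DecidableEq (Fin m × Fin n))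
  | .samples m, n => inferInstanceAs (DecidableEq (Fin m × Fin n))
  | .quantumSample, n => inferInstanceAs (DecidableEq (Fin n))
  | .purified, n => inferInstanceAs (DecidableEq (Fin n × Fin n))

/-- `U` prepares the quantum sample of `p`: `U|0⟩ = ∑ᵢ √pᵢ |i⟩`. -/
def IsQuantumSampleOracle {n : ℕ} [NeZero n] (p : Fin n → ℝ) (U : Matrix (Fin n) (Fin n) ℂ) :
    Prop :=
  U ∈ Matrix.unitaryGroup (Fin n) ℂ ∧ ∀ i, U i 0 = (√(p i) : ℂ)

/-- `U` is a purified access oracle of `p`: `U|0⟩|0⟩ = ∑ᵢ √pᵢ |ψᵢ⟩|i⟩` for some orthonormal family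
of vectors `ψᵢ`. -/
def IsPurifiedOracle {n : ℕ} [NeZero n] (p : Fin n → ℝ)
    (U : Matrix (Fin n × Fin n) (Fin n × Fin n) ℂ) : Prop :=
  U ∈ Matrix.unitaryGroup (Fin n × Fin n) ℂ ∧
    ∃ ψ : Fin n → EuclideanSpace ℂ (Fin n), Orthonormal ℂ ψ ∧
      ∀ a i, U (a, i) (0, 0) = (√(p i) : ℂ) * ψ i a

/-- With access to `p` in the given model, the algorithm returns a number in `S` with probability
at least `s`: for every oracle that represents `p`, and in the model of classically drawn samples
with respect to the joint randomness of the samples and of the final measurement. -/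
def Succeeds {n : ℕ} [NeZero n] : (M : InputModel) → QueryAlgorithm (M.Reg n) →
    (s : ℝ) → (p : Fin n → ℝ) → (S : Set ℝ) → Prop
  | .frequency m, A, s, p, S =>
      ∀ v : Fin m → Fin n, frequencies v = p → s ≤ A.outputProb (stringOracle v) S
  | .samples m, A, s, p, S =>
      s ≤ ∑ v : Fin m → Fin n, (∏ j, p (v j)) * A.outputProb (stringOracle v) S
  | .quantumSample, A, s, p, S =>
      ∀ U, IsQuantumSampleOracle p U → s ≤ A.outputProb U S
  | .purified, A, s, p, S =>
      ∀ U, IsPurifiedOracle p U → s ≤ A.outputProb U S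

/-- Some oracle of the model represents the distribution `p`.  This is a restriction only for
frequency vectors, where `p` has to be the frequency vector of a string of the given length. -/
def Represents {n : ℕ} : InputModel → (Fin n → ℝ) → Prop
  | .frequency m, p => ∃ v : Fin m → Fin n, frequencies v = p
  | .samples _, _ => True
  | .quantumSample, _ => True
  | .purified, _ => True

/-- The algorithm distinguishes `p` from `q` with success probability `s`: it answers `1` on `p`
and `0` on `q`. -/
def Distinguishes {n : ℕ} [NeZero n] (M : InputModel) (A : QueryAlgorithm (M.Reg n)) (s : ℝ)
    (p q : Fin n → ℝ) : Prop :=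
  M.Succeeds A s p {1} ∧ M.Succeeds A s q {0}

/-- The algorithm outputs, with probability at least `s`, a `γ`-multiplicative approximation of the
entropy, for every input distribution on `n` labels. -/
def EstimatesEntropy {n : ℕ} [NeZero n] (M : InputModel) (A : QueryAlgorithm (M.Reg n)) (s γ : ℝ) :
    Prop :=
  ∀ p ∈ stdSimplex ℝ (Fin n),
    M.Succeeds A s p (Set.Icc (shannonEntropy p / γ) (γ * shannonEntropy p))

end InputModel

end

/-!
The lower bounds come from the hybrid argument, run in the mean: if a random oracle `U` and a fixed
oracle `V` satisfy `E ‖(U - V) y‖² ≤ δ² ‖y‖²` for every vector `y`, then each query moves the states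
apart by at most `δ` in quadratic mean, so that `T` queries tell `U` from `V` with probability `s`
only if `2 s - 1 ≤ 2 δ T`.

For unitary oracles, a unitary close to the identity, a product of two reflections, carries one
column of amplitudes to the other, and `δ` is their Euclidean distance, `√2` times the Hellinger
distance. String oracles at different strings are far apart in norm, however rarely the strings
differ. A string with frequencies `p` shifted cyclically at random, like a string sampled from `p`,
differs from `0` at each fixed position with probability `1 - p 0`, whence `δ = 2 √(1 - p 0)`
against the all-zero string.
-/

section UnitaryTransport

open scoped InnerProductSpace

theorem norm_sub_sq_le_of_mul_mul_eq_smul {𝕜 A : Type*} [RCLike 𝕜] [NormedRing A] [StarRing A]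
    [CStarRing A] [NormedAlgebra 𝕜 A] {p q : A} (hp : IsStarProjection p)
    (hq : IsStarProjection q) {κ : ℝ} (hκ : κ ≤ 1) (hpqp : p * q * p = (κ : 𝕜) • p)
    (hqpq : q * p * q = (κ : 𝕜) • q) : ‖p - q‖ ^ 2 ≤ 1 - κ := by
  have sub_isSelfAdjoint : IsSelfAdjoint (p - q) := hp.isSelfAdjoint.sub hq.isSelfAdjoint
  have sq_isSelfAdjoint : IsSelfAdjoint ((p - q) * (p - q)) := by
    simpa only [pow_two] using sub_isSelfAdjoint.pow 2
  have cube : (p - q) * (p - q) * (p - q) = ((1 - κ : ℝ) : 𝕜) • (p - q) := by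
    have hpp : p * p = p := hp.isIdempotentElem
    have hqq : q * q = q := hq.isIdempotentElem
    simp only [mul_sub, sub_mul, hpp, hqq, hpqp, hqpq, mul_assoc p q q, mul_assoc q p p]
    push_cast
    module
  have fourth : ‖p - q‖ ^ 2 * ‖p - q‖ ^ 2 = (1 - κ) * ‖p - q‖ ^ 2 := by
    calc ‖p - q‖ ^ 2 * ‖p - q‖ ^ 2 = ‖(p - q) * (p - q) * ((p - q) * (p - q))‖ := by
          rw [sq_isSelfAdjoint.norm_mul_self, sub_isSelfAdjoint.norm_mul_self,
            pow_two (‖p - q‖ ^ 2)]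
      _ = (1 - κ) * ‖p - q‖ ^ 2 := by
          rw [← mul_assoc, cube, smul_mul_assoc, norm_smul, sub_isSelfAdjoint.norm_mul_self,
            RCLike.norm_of_nonneg (sub_nonneg.2 hκ)]
  rcases (norm_nonneg (p - q)).eq_or_lt with h | h
  · rw [← h]
    linarith
  · exact (mul_right_cancel₀ (pow_pos h 2).ne' fourth).le

theorem norm_two_mul_sub_one_mul_two_mul_sub_one_sub_one {𝕜 A : Type*} [RCLike 𝕜]
    [NormedRing A] [StarRing A] [CStarRing A] [NormedAlgebra 𝕜 A] {p q : A}
    (hq : IsStarProjection q) : ‖(2 * p - 1) * (2 * q - 1) - 1‖ = 2 * ‖p - q‖ := by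
  have mul_self : (2 * q - 1) * (2 * q - 1) = 1 := by
    have hqq : q * q = q := hq.isIdempotentElem
    simp only [mul_sub, sub_mul, two_mul, add_mul, mul_add, hqq, mul_one, one_mul]
    abel
  calc ‖(2 * p - 1) * (2 * q - 1) - 1‖
      = ‖(2 * p - 1 - (2 * q - 1)) * (2 * q - 1)‖ := by rw [sub_mul (2 * p - 1), mul_self]
    _ = ‖(2 : 𝕜) • (p - q)‖ := by
        rw [CStarRing.norm_mul_mem_unitary _ hq.two_mul_sub_one_mem_unitary,
          sub_sub_sub_cancel_right, ← mul_sub, two_mul, two_smul]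
    _ = 2 * ‖p - q‖ := by rw [norm_smul, RCLike.norm_two]

variable {𝕜 H : Type*} [RCLike 𝕜] [NormedAddCommGroup H] [InnerProductSpace 𝕜 H]

theorem starProjection_span_singleton_mul_mul (v w : H) :
    (𝕜 ∙ v).starProjection * (𝕜 ∙ w).starProjection * (𝕜 ∙ v).starProjection =
      ((‖⟪v, w⟫_𝕜‖ ^ 2 / (‖v‖ ^ 2 * ‖w‖ ^ 2) : ℝ) : 𝕜) • (𝕜 ∙ v).starProjection := by
  ext x
  have hvw : ⟪v, w⟫_𝕜 * ⟪w, v⟫_𝕜 = (‖⟪v, w⟫_𝕜‖ : 𝕜) ^ 2 := by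
    rw [← inner_conj_symm w v, RCLike.mul_conj]
  simp only [ContinuousLinearMap.mul_def, ContinuousLinearMap.comp_apply, smul_apply,
    Submodule.starProjection_singleton, inner_smul_right, smul_smul]
  push_cast
  rw [← hvw]
  congr 1
  ring

theorem norm_starProjection_span_singleton_sub_sq_le [CompleteSpace H] (v w : H) :
    ‖(𝕜 ∙ v).starProjection - (𝕜 ∙ w).starProjection‖ ^ 2 ≤
      1 - ‖⟪v, w⟫_𝕜‖ ^ 2 / (‖v‖ ^ 2 * ‖w‖ ^ 2) := by
  refine norm_sub_sq_le_of_mul_mul_eq_smul (𝕜 := 𝕜) isStarProjection_starProjection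
    isStarProjection_starProjection (div_le_one_of_le₀ ?_ (by positivity))
    (starProjection_span_singleton_mul_mul v w) ?_
  · rw [← mul_pow]
    exact pow_le_pow_left₀ (norm_nonneg _) (norm_inner_le_norm v w) 2
  · rw [starProjection_span_singleton_mul_mul, norm_inner_symm, mul_comm (‖w‖ ^ 2)]

/-- The product of the reflections in the lines spanned by `e` and by `e + u` turns `e` into `u`,
and its distance to the identity is the distance of the two reflections. -/
theorem exists_mem_unitary_apply_eq_norm_sub_one_le [CompleteSpace H] {e u : H} (he : ‖e‖ = 1)
    (hu : ‖u‖ = 1) {c : ℝ} (hc : -1 < c) (heu : ⟪e, u⟫_𝕜 = c) :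
    ∃ W ∈ unitary (H →L[𝕜] H), W e = u ∧ ‖W - 1‖ ≤ ‖u - e‖ := by
  set P := (𝕜 ∙ e).starProjection
  set P' := (𝕜 ∙ (e + u)).starProjection
  have hP : IsStarProjection P := isStarProjection_starProjection
  have hR := hP.two_mul_sub_one_mem_unitary
  have hR' := (isStarProjection_starProjection : IsStarProjection P').two_mul_sub_one_mem_unitary
  have hc' : 1 + c ≠ 0 := by linarith
  have inner_add : ⟪e + u, e⟫_𝕜 = ((1 + c : ℝ) : 𝕜) := by
    rw [inner_add_left, inner_self_eq_norm_sq_to_K, he, ← inner_conj_symm, heu]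
    simp
  have norm_add_sq : ‖e + u‖ ^ 2 = 2 * (1 + c) := by
    rw [norm_add_sq (𝕜 := 𝕜), heu, he, hu, RCLike.ofReal_re]
    ring
  have norm_sub_sq : ‖u - e‖ ^ 2 = 2 * (1 - c) := by
    rw [norm_sub_rev, norm_sub_sq (𝕜 := 𝕜), heu, he, hu, RCLike.ofReal_re]
    ring
  have map_e : ((2 * P' - 1) * (2 * P - 1)) e = u := by
    have hPe : P e = e :=
      Submodule.starProjection_eq_self_iff.2 (Submodule.mem_span_singleton_self e)
    have hP'e : P' e = (2⁻¹ : 𝕜) • (e + u) := by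
      rw [Submodule.starProjection_singleton, inner_add, norm_add_sq,
        ← RCLike.ofReal_div, mul_comm 2, div_mul_cancel_left₀ hc',
        RCLike.ofReal_inv, RCLike.ofReal_ofNat]
    have hPe' : (2 * P - 1) e = e := by simp [two_mul, hPe]
    rw [ContinuousLinearMap.mul_def, ContinuousLinearMap.comp_apply, hPe']
    simp only [two_mul, sub_apply, add_apply, hP'e, smul_add, one_apply_eq_self]
    module
  refine ⟨(2 * P' - 1) * (2 * P - 1), mul_mem hR' hR, map_e, ?_⟩
  rw [norm_two_mul_sub_one_mul_two_mul_sub_one_sub_one (𝕜 := 𝕜) hP]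
  refine (abs_le_of_sq_le_sq' ?_ (norm_nonneg _)).2
  have h := norm_starProjection_span_singleton_sub_sq_le (𝕜 := 𝕜) (e + u) e
  rw [inner_add, he, norm_add_sq, RCLike.norm_ofReal, sq_abs] at h
  rw [norm_sub_sq]
  field_simp at h ⊢
  linarith

theorem exists_mem_unitary_apply_eq_norm_sub_le [CompleteSpace H] {e u v : H} (he : ‖e‖ = 1)
    (hu : ‖u‖ = 1) (hv : ‖v‖ = 1) {c d : ℝ} (hc : -1 < c) (hd : -1 < d) (hev : ⟪e, v⟫_𝕜 = c)
    (hvu : ⟪v, u⟫_𝕜 = d) :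
    ∃ U ∈ unitary (H →L[𝕜] H), ∃ V ∈ unitary (H →L[𝕜] H),
      U e = u ∧ V e = v ∧ ‖U - V‖ ≤ ‖u - v‖ := by
  obtain ⟨V, hV, hVe, -⟩ := exists_mem_unitary_apply_eq_norm_sub_one_le he hv hc hev
  obtain ⟨W, hW, hWv, hle⟩ := exists_mem_unitary_apply_eq_norm_sub_one_le hv hu hd hvu
  refine ⟨W * V, mul_mem hW hV, V, hV, ?_, hVe, ?_⟩
  · rw [ContinuousLinearMap.mul_def, ContinuousLinearMap.comp_apply, hVe, hWv]
  · calc ‖W * V - V‖ = ‖(W - 1) * V‖ := by rw [sub_mul, one_mul]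
      _ = ‖W - 1‖ := CStarRing.norm_mul_mem_unitary _ hV
      _ ≤ ‖u - v‖ := hle

theorem toEuclideanCLM_mem_unitary_iff {Q : Type*} [Fintype Q] [DecidableEq Q]
    {M : Matrix Q Q 𝕜} :
    Matrix.toEuclideanCLM (𝕜 := 𝕜) M ∈ unitary (EuclideanSpace 𝕜 Q →L[𝕜] EuclideanSpace 𝕜 Q) ↔
      M ∈ Matrix.unitaryGroup Q 𝕜 := by
  rw [Unitary.mem_iff, Matrix.unitaryGroup, Unitary.mem_iff, ← map_star, ← map_mul, ← map_mul,
    EmbeddingLike.map_eq_one_iff, EmbeddingLike.map_eq_one_iff]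

open scoped Matrix.Norms.L2Operator in
theorem exists_mem_unitaryGroup_apply_eq_norm_sub_le {Q : Type*} [Fintype Q] [DecidableEq Q]
    (x₀ : Q) {a b : Q → ℝ} (ha : 0 ≤ a) (hb : 0 ≤ b) (ha' : ∑ x, a x ^ 2 = 1)
    (hb' : ∑ x, b x ^ 2 = 1) :
    ∃ U ∈ Matrix.unitaryGroup Q ℂ, ∃ V ∈ Matrix.unitaryGroup Q ℂ,
      (∀ x, U x x₀ = a x) ∧ (∀ x, V x x₀ = b x) ∧ ‖U - V‖ ≤ √(∑ x, (a x - b x) ^ 2) := by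
  let e : EuclideanSpace ℂ Q := EuclideanSpace.single x₀ 1
  let amp (c : Q → ℝ) : EuclideanSpace ℂ Q := WithLp.toLp 2 fun x => (c x : ℂ)
  have norm_e : ‖e‖ = 1 := (PiLp.norm_single 2 (fun _ => ℂ) x₀ 1).trans norm_one
  have norm_amp (c : Q → ℝ) (hc : ∑ x, c x ^ 2 = 1) : ‖amp c‖ = 1 := by
    simp [EuclideanSpace.norm_eq, amp, hc]
  have inner_amp (c d : Q → ℝ) : ⟪amp c, amp d⟫_ℂ = (∑ x, c x * d x : ℝ) := by
    simp [amp, PiLp.inner_apply, mul_comm]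
  have inner_e (c : Q → ℝ) : ⟪e, amp c⟫_ℂ = (c x₀ : ℝ) := by
    rw [EuclideanSpace.inner_single_left, map_one, one_mul]
  have neg_one_lt_inner : -1 < ∑ x, b x * a x :=
    neg_one_lt_zero.trans_le (Finset.sum_nonneg fun x _ => mul_nonneg (hb x) (ha x))
  obtain ⟨U', hU, V', hV, hUe, hVe, hle⟩ := exists_mem_unitary_apply_eq_norm_sub_le norm_e
    (norm_amp a ha') (norm_amp b hb') (neg_one_lt_zero.trans_le (hb x₀)) neg_one_lt_inner
    (inner_e b) (inner_amp b a)
  obtain ⟨U, rfl⟩ := EquivLike.surjective (Matrix.toEuclideanCLM (𝕜 := ℂ) (n := Q)) U'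
  obtain ⟨V, rfl⟩ := EquivLike.surjective (Matrix.toEuclideanCLM (𝕜 := ℂ) (n := Q)) V'
  have col (M : Matrix Q Q ℂ) (x : Q) :
      M x x₀ = Matrix.toEuclideanCLM (𝕜 := ℂ) M e x := by
    rw [Matrix.ofLp_toEuclideanCLM]
    simp [e]
  refine ⟨U, toEuclideanCLM_mem_unitary_iff.1 hU, V, toEuclideanCLM_mem_unitary_iff.1 hV,
    fun x => (col U x).trans (by rw [hUe]), fun x => (col V x).trans (by rw [hVe]), ?_⟩
  rw [Matrix.cstar_norm_def, map_sub]
  refine hle.trans_eq ?_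
  simp [EuclideanSpace.norm_eq, amp, ← Complex.ofReal_sub]

end UnitaryTransport

section HybridArgument

open WithLp

section Euclidean

variable {𝕜 Q R : Type*} [RCLike 𝕜] [Fintype Q] [Fintype R]

theorem norm_toLp_mulVec_of_mem_unitaryGroup [DecidableEq Q] {M : Matrix Q Q 𝕜}
    (hM : M ∈ Matrix.unitaryGroup Q 𝕜) (x : Q → 𝕜) : ‖toLp 2 (M *ᵥ x)‖ = ‖toLp 2 x‖ := by
  rw [← Matrix.toEuclideanCLM_toLp]
  exact ContinuousLinearMap.norm_map_of_mem_unitary (toEuclideanCLM_mem_unitary_iff.2 hM) _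

theorem norm_toLp_prod_sq (x : Q × R → 𝕜) :
    ‖toLp 2 x‖ ^ 2 = ∑ q, ‖toLp 2 fun r => x (q, r)‖ ^ 2 := by
  simp only [EuclideanSpace.norm_sq_eq, Fintype.sum_prod_type]

theorem norm_toLp_prod_sq_right (x : Q × R → 𝕜) :
    ‖toLp 2 x‖ ^ 2 = ∑ r, ‖toLp 2 fun q => x (q, r)‖ ^ 2 := by
  simp only [EuclideanSpace.norm_sq_eq, Fintype.sum_prod_type_right]

theorem blockDiagonal_mulVec_apply [DecidableEq R] (D : R → Matrix Q Q 𝕜) (x : Q × R → 𝕜) (q : Q)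
    (r : R) : (Matrix.blockDiagonal D *ᵥ x) (q, r) = (D r *ᵥ fun q' => x (q', r)) q := by
  simp only [Matrix.mulVec, dotProduct, Fintype.sum_prod_type, Matrix.blockDiagonal_apply,
    ite_mul, zero_mul, Finset.sum_ite_eq, Finset.mem_univ, if_true]

theorem norm_toLp_indicator_le (T : Set Q) (x : Q → 𝕜) :
    ‖toLp 2 (T.indicator x)‖ ≤ ‖toLp 2 x‖ := by
  simp only [EuclideanSpace.norm_eq]
  gcongr with q
  exact norm_indicator_le_norm_self x q

theorem norm_toLp_indicator_sq_le {x y : Q → 𝕜} (hx : ‖toLp 2 x‖ ≤ 1) (hy : ‖toLp 2 y‖ ≤ 1)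
    (T : Set Q) :
    ‖toLp 2 (T.indicator x)‖ ^ 2 ≤ ‖toLp 2 (T.indicator y)‖ ^ 2 + 2 * ‖toLp 2 (x - y)‖ := by
  have hdiff : ‖toLp 2 (T.indicator x)‖ - ‖toLp 2 (T.indicator y)‖ ≤ ‖toLp 2 (x - y)‖ :=
    calc _ ≤ ‖toLp 2 (T.indicator (x - y))‖ := by
          rw [Set.indicator_sub', toLp_sub]
          exact norm_sub_norm_le _ _
      _ ≤ _ := norm_toLp_indicator_le T _
  have hx' := (norm_toLp_indicator_le T x).trans hx
  have hy' := (norm_toLp_indicator_le T y).trans hy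
  nlinarith [norm_nonneg (toLp 2 (T.indicator x)), norm_nonneg (toLp 2 (T.indicator y)),
    norm_nonneg (toLp 2 (x - y))]

end Euclidean

namespace QueryMode

variable {ι : Type*} {Q : Type} [Fintype ι] [Fintype Q] [DecidableEq Q]

theorem op_mem_unitaryGroup {U : Matrix Q Q ℂ} (hU : U ∈ Matrix.unitaryGroup Q ℂ) :
    ∀ μ : QueryMode, μ.op U ∈ Matrix.unitaryGroup Q ℂ
  | forward => hU
  | inverse => Unitary.star_mem hU
  | skip => one_mem _

/-- In the mean over `i` with weights `w`, a query to `U i` differs from the same query to `V` by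
at most `δ` on every unit vector. -/
def MeanClose (w : ι → ℝ) (U : ι → Matrix Q Q ℂ) (V : Matrix Q Q ℂ) (δ : ℝ) : Prop :=
  ∀ (μ : QueryMode) (y : Q → ℂ),
    ∑ i, w i * ‖toLp 2 ((μ.op (U i) - μ.op V) *ᵥ y)‖ ^ 2 ≤ δ ^ 2 * ‖toLp 2 y‖ ^ 2

open scoped Matrix.Norms.L2Operator in
theorem meanClose_of_norm_sub_le {U V : Matrix Q Q ℂ} {δ : ℝ} (h : ‖U - V‖ ≤ δ) :
    MeanClose (fun _ : Unit => 1) (fun _ => U) V δ := by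
  have norm_op_sub_le : ∀ μ : QueryMode, ‖μ.op U - μ.op V‖ ≤ δ
    | forward => h
    | inverse => by
      rw [op, op, ← Matrix.conjTranspose_sub, Matrix.l2_opNorm_conjTranspose]
      exact h
    | skip => by
      rw [op, op, sub_self, norm_zero]
      exact (norm_nonneg _).trans h
  intro μ y
  rw [Fintype.sum_unique, one_mul, ← mul_pow]
  gcongr
  exact (Matrix.l2_opNorm_mulVec _ (toLp 2 y)).trans (by gcongr; exact norm_op_sub_le μ)

end QueryMode

namespace QueryAlgorithm

variable {ι : Type*} {Q : Type} [Fintype ι] [Fintype Q] [DecidableEq Q] (A : QueryAlgorithm Q)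
  {U V : Matrix Q Q ℂ}

theorem queryMatrix_mem_unitaryGroup (hU : U ∈ Matrix.unitaryGroup Q ℂ) (t : ℕ) :
    A.queryMatrix U t ∈ Matrix.unitaryGroup (Q × Fin A.workDim) ℂ := by
  rw [Matrix.mem_unitaryGroup_iff', Matrix.star_eq_conjTranspose, queryMatrix,
    Matrix.blockDiagonal_conjTranspose, ← Matrix.blockDiagonal_mul, ← Matrix.blockDiagonal_one]
  congr 1
  funext w
  exact Matrix.mem_unitaryGroup_iff'.1 (QueryMode.op_mem_unitaryGroup hU _)

theorem norm_state (hU : U ∈ Matrix.unitaryGroup Q ℂ) (t : ℕ) : ‖toLp 2 (A.state U t)‖ = 1 := by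
  induction t with
  | zero =>
    rw [state, norm_toLp_mulVec_of_mem_unitaryGroup (A.gate 0).2]
    exact (PiLp.norm_single 2 (fun _ => ℂ) A.start 1).trans norm_one
  | succ t ih =>
    rw [state, norm_toLp_mulVec_of_mem_unitaryGroup (A.gate _).2,
      norm_toLp_mulVec_of_mem_unitaryGroup (A.queryMatrix_mem_unitaryGroup hU t), ih]

theorem norm_state_succ_sub_le (hU : U ∈ Matrix.unitaryGroup Q ℂ) (V : Matrix Q Q ℂ) (t : ℕ) :
    ‖toLp 2 (A.state U (t + 1) - A.state V (t + 1))‖ ≤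
      ‖toLp 2 (A.state U t - A.state V t)‖ +
        ‖toLp 2 ((A.queryMatrix U t - A.queryMatrix V t) *ᵥ A.state V t)‖ := by
  have split : A.queryMatrix U t *ᵥ A.state U t - A.queryMatrix V t *ᵥ A.state V t =
      A.queryMatrix U t *ᵥ (A.state U t - A.state V t) +
        (A.queryMatrix U t - A.queryMatrix V t) *ᵥ A.state V t := by
    rw [Matrix.mulVec_sub, Matrix.sub_mulVec]
    abel
  rw [state, state, ← Matrix.mulVec_sub, norm_toLp_mulVec_of_mem_unitaryGroup (A.gate _).2, split,
    toLp_add]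
  refine (norm_add_le _ _).trans_eq ?_
  rw [norm_toLp_mulVec_of_mem_unitaryGroup (A.queryMatrix_mem_unitaryGroup hU t)]

theorem norm_queryMatrix_sub_mulVec_sq (U V : Matrix Q Q ℂ) (t : ℕ) (x : Q × Fin A.workDim → ℂ) :
    ‖toLp 2 ((A.queryMatrix U t - A.queryMatrix V t) *ᵥ x)‖ ^ 2 =
      ∑ r, ‖toLp 2 (((A.mode t r).op U - (A.mode t r).op V) *ᵥ fun q => x (q, r))‖ ^ 2 := by
  rw [queryMatrix, queryMatrix, ← Matrix.blockDiagonal_sub, norm_toLp_prod_sq_right]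
  simp only [blockDiagonal_mulVec_apply, Pi.sub_apply]

section Mean

variable {w : ι → ℝ} {U : ι → Matrix Q Q ℂ} {δ : ℝ}

theorem sum_norm_queryMatrix_sub_mulVec_le (hw : w ∈ stdSimplex ℝ ι) (hδ : 0 ≤ δ)
    (h : QueryMode.MeanClose w U V δ) (t : ℕ) (x : Q × Fin A.workDim → ℂ) :
    ∑ i, w i * ‖toLp 2 ((A.queryMatrix (U i) t - A.queryMatrix V t) *ᵥ x)‖ ≤ δ * ‖toLp 2 x‖ := by
  refine (abs_le_of_sq_le_sq' ?_ (by positivity)).2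
  calc (∑ i, w i * ‖toLp 2 ((A.queryMatrix (U i) t - A.queryMatrix V t) *ᵥ x)‖) ^ 2
      ≤ ∑ i, w i * ‖toLp 2 ((A.queryMatrix (U i) t - A.queryMatrix V t) *ᵥ x)‖ ^ 2 :=
        Real.pow_arith_mean_le_arith_mean_pow_of_even _ _ _ (fun i _ => hw.1 i) hw.2 even_two
    _ = ∑ r, ∑ i, w i * ‖toLp 2 (((A.mode t r).op (U i) - (A.mode t r).op V) *ᵥ
          fun q => x (q, r))‖ ^ 2 := by
        simp only [norm_queryMatrix_sub_mulVec_sq, Finset.mul_sum]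
        exact Finset.sum_comm
    _ ≤ ∑ r, δ ^ 2 * ‖toLp 2 fun q => x (q, r)‖ ^ 2 := Finset.sum_le_sum fun r _ => h _ _
    _ = (δ * ‖toLp 2 x‖) ^ 2 := by rw [← Finset.mul_sum, ← norm_toLp_prod_sq_right, mul_pow]

theorem sum_norm_state_sub_le (hw : w ∈ stdSimplex ℝ ι) (hδ : 0 ≤ δ)
    (hU : ∀ i, U i ∈ Matrix.unitaryGroup Q ℂ) (hV : V ∈ Matrix.unitaryGroup Q ℂ)
    (h : QueryMode.MeanClose w U V δ) (t : ℕ) :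
    ∑ i, w i * ‖toLp 2 (A.state (U i) t - A.state V t)‖ ≤ t * δ := by
  induction t with
  | zero => simp [state]
  | succ t ih =>
    calc ∑ i, w i * ‖toLp 2 (A.state (U i) (t + 1) - A.state V (t + 1))‖
        ≤ ∑ i, w i * (‖toLp 2 (A.state (U i) t - A.state V t)‖ +
            ‖toLp 2 ((A.queryMatrix (U i) t - A.queryMatrix V t) *ᵥ A.state V t)‖) := by
          gcongr with i
          · exact hw.1 i
          · exact A.norm_state_succ_sub_le (hU i) V t
      _ ≤ t * δ + δ * ‖toLp 2 (A.state V t)‖ := by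
          simp only [mul_add, Finset.sum_add_distrib]
          exact add_le_add ih (A.sum_norm_queryMatrix_sub_mulVec_le hw hδ h t _)
      _ = (t + 1 : ℕ) * δ := by
          rw [A.norm_state hV]
          push_cast
          ring

end Mean

theorem outputProb_eq_norm_indicator_sq (U : Matrix Q Q ℂ) (S : Set ℝ) :
    A.outputProb U S = ‖toLp 2 ((A.output ⁻¹' S).indicator (A.state U A.queries))‖ ^ 2 := by
  classical
  rw [outputProb, EuclideanSpace.norm_sq_eq]
  refine Finset.sum_congr rfl fun x _ => ?_
  by_cases hx : A.output x ∈ S <;> simp [hx]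

theorem outputProb_add_le_one (hU : U ∈ Matrix.unitaryGroup Q ℂ) {S S' : Set ℝ}
    (hS : Disjoint S S') : A.outputProb U S + A.outputProb U S' ≤ 1 := by
  classical
  rw [← one_pow 2, ← A.norm_state hU A.queries, EuclideanSpace.norm_sq_eq, outputProb, outputProb,
    ← Finset.sum_add_distrib]
  refine Finset.sum_le_sum fun x _ => ?_
  by_cases hx : A.output x ∈ S
  · simp [hx, Set.disjoint_left.1 hS hx]
  · by_cases hx' : A.output x ∈ S' <;> simp [hx, hx']

theorem outputProb_le_outputProb_add (hU : U ∈ Matrix.unitaryGroup Q ℂ)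
    (hV : V ∈ Matrix.unitaryGroup Q ℂ) (S : Set ℝ) :
    A.outputProb U S ≤
      A.outputProb V S + 2 * ‖toLp 2 (A.state U A.queries - A.state V A.queries)‖ := by
  simp only [outputProb_eq_norm_indicator_sq]
  exact norm_toLp_indicator_sq_le (A.norm_state hU _).le (A.norm_state hV _).le _

theorem two_mul_sub_one_le_of_meanClose {w : ι → ℝ} {U : ι → Matrix Q Q ℂ} {δ : ℝ}
    (hw : w ∈ stdSimplex ℝ ι) (hδ : 0 ≤ δ) (hU : ∀ i, U i ∈ Matrix.unitaryGroup Q ℂ)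
    (hV : V ∈ Matrix.unitaryGroup Q ℂ) (h : QueryMode.MeanClose w U V δ) {S S' : Set ℝ}
    (hS : Disjoint S S') {s : ℝ} (hUS : s ≤ ∑ i, w i * A.outputProb (U i) S)
    (hVS : s ≤ A.outputProb V S') : 2 * s - 1 ≤ 2 * δ * A.queries := by
  have mean_outputProb_le : ∑ i, w i * A.outputProb (U i) S ≤
      A.outputProb V S + 2 * (A.queries * δ) :=
    calc ∑ i, w i * A.outputProb (U i) S
        ≤ ∑ i, w i * (A.outputProb V S +
            2 * ‖toLp 2 (A.state (U i) A.queries - A.state V A.queries)‖) := by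
          gcongr with i
          · exact hw.1 i
          · exact A.outputProb_le_outputProb_add (hU i) hV S
      _ = A.outputProb V S +
            2 * ∑ i, w i * ‖toLp 2 (A.state (U i) A.queries - A.state V A.queries)‖ := by
          simp only [mul_add, Finset.sum_add_distrib, ← Finset.sum_mul, hw.2, one_mul,
            mul_left_comm (w _) 2, ← Finset.mul_sum]
      _ ≤ A.outputProb V S + 2 * (A.queries * δ) := by
          gcongr
          exact A.sum_norm_state_sub_le hw hδ hU hV h A.queries
  linarith [A.outputProb_add_le_one hV hS]

end QueryAlgorithm

end HybridArgument

section RandomStrings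

open WithLp

theorem sum_filter_prod_apply {ι κ R : Type*} [Fintype ι] [DecidableEq ι] [Fintype κ]
    [DecidableEq κ] [CommSemiring R] {p : κ → R} (hp : ∑ b, p b = 1) (j : ι) (s : Finset κ) :
    ∑ v : ι → κ with v j ∈ s, ∏ k, p (v k) = ∑ b ∈ s, p b := by
  have filter_eq : ({v : ι → κ | v j ∈ s} : Finset (ι → κ)) =
      Fintype.piFinset (Function.update (fun _ => Finset.univ) j s) := by
    ext v
    simp [Fintype.mem_piFinset, Function.forall_update_iff _ fun k t => v k ∈ t]
  rw [filter_eq, ← Finset.prod_univ_sum, Fintype.prod_eq_single j fun k hk => by simp [hk, hp],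
    Function.update_self]

theorem prod_apply_mem_stdSimplex {ι κ : Type*} [Fintype ι] [DecidableEq ι]
    [Fintype κ] {p : κ → ℝ} (hp : p ∈ stdSimplex ℝ κ) :
    (fun v : ι → κ => ∏ k, p (v k)) ∈ stdSimplex ℝ (ι → κ) := by
  refine ⟨fun v => Finset.prod_nonneg fun k _ => hp.1 _, ?_⟩
  rw [← Fintype.piFinset_univ, ← Finset.prod_univ_sum]
  simp [hp.2]

variable {m n : ℕ}

/-- The label by which a query of the given mode translates the answer register when the entry read
is `a`; amplitudes are looked up at the translated index, so a forward query gives `-a`. -/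
def QueryMode.labelShift [NeZero n] (a : Fin n) : QueryMode → Fin n
  | .forward => -a
  | .inverse => a
  | .skip => 0

theorem stringOracle_mulVec [NeZero n] (v : Fin m → Fin n) (y : Fin m × Fin n → ℂ) :
    stringOracle v *ᵥ y = fun x => y (x.1, x.2 - v x.1) := by
  ext ⟨j, b⟩
  have preimage (x : Fin m × Fin n) : (j, b) = (x.1, x.2 + v x.1) ↔ (j, b - v j) = x := by
    constructor
    · rintro h
      obtain ⟨rfl, rfl⟩ := Prod.mk.inj h
      simp
    · rintro rfl
      simp
  simp [stringOracle, Matrix.mulVec, dotProduct, preimage]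

theorem conjTranspose_stringOracle_mulVec (v : Fin m → Fin n) (y : Fin m × Fin n → ℂ) :
    (stringOracle v)ᴴ *ᵥ y = fun x => y (x.1, x.2 + v x.1) := by
  ext x
  simp [stringOracle, Matrix.mulVec, dotProduct, apply_ite star]

theorem QueryMode.op_stringOracle_mulVec [NeZero n] (v : Fin m → Fin n) (y : Fin m × Fin n → ℂ) :
    ∀ μ : QueryMode,
      μ.op (stringOracle v) *ᵥ y = fun x => y (x.1, x.2 + μ.labelShift (v x.1))
  | forward => by simp only [op, labelShift, stringOracle_mulVec, sub_eq_add_neg]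
  | inverse => conjTranspose_stringOracle_mulVec v y
  | skip => by simp [op, labelShift]

theorem norm_op_stringOracle_sub_mulVec_sq_le [NeZero n] (v u : Fin m → Fin n) (μ : QueryMode)
    (y : Fin m × Fin n → ℂ) :
    ‖toLp 2 ((μ.op (stringOracle v) - μ.op (stringOracle u)) *ᵥ y)‖ ^ 2 ≤
      ∑ j with v j ≠ u j, 4 * ‖toLp 2 fun b => y (j, b)‖ ^ 2 := by
  rw [Matrix.sub_mulVec, QueryMode.op_stringOracle_mulVec, QueryMode.op_stringOracle_mulVec,
    norm_toLp_prod_sq, Finset.sum_filter]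
  gcongr with j
  split_ifs with hj
  · have norm_shift (a : Fin n) :
        ‖toLp 2 fun b => y (j, b + a)‖ = ‖toLp 2 fun b => y (j, b)‖ := by
      simp only [EuclideanSpace.norm_eq]
      exact congrArg _ (Equiv.sum_comp (Equiv.addRight a) fun b => ‖y (j, b)‖ ^ 2)
    have norm_le := norm_sub_le (toLp 2 fun b => y (j, b + μ.labelShift (v j)))
      (toLp 2 fun b => y (j, b + μ.labelShift (u j)))
    rw [norm_shift, norm_shift, ← two_mul, ← toLp_sub] at norm_le
    calc _ ≤ (2 * ‖toLp 2 fun b => y (j, b)‖) ^ 2 := pow_le_pow_left₀ (norm_nonneg _) norm_le 2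
      _ = 4 * ‖toLp 2 fun b => y (j, b)‖ ^ 2 := by ring
  · simp [not_not.1 hj, ← Pi.zero_def]

theorem meanClose_stringOracle [NeZero n] {ι : Type*} [Fintype ι] {w : ι → ℝ} (hw : 0 ≤ w)
    {v : ι → Fin m → Fin n} {u : Fin m → Fin n} {ε : ℝ} (hε : 0 ≤ ε)
    (h : ∀ j, ∑ i with v i j ≠ u j, w i ≤ ε) :
    QueryMode.MeanClose w (fun i => stringOracle (v i)) (stringOracle u) (2 * √ε) := by
  intro μ y
  calc ∑ i, w i * ‖toLp 2 ((μ.op (stringOracle (v i)) - μ.op (stringOracle u)) *ᵥ y)‖ ^ 2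
      ≤ ∑ i, w i * ∑ j with v i j ≠ u j, 4 * ‖toLp 2 fun b => y (j, b)‖ ^ 2 := by
        gcongr with i
        · exact hw i
        · exact norm_op_stringOracle_sub_mulVec_sq_le _ _ μ y
    _ = ∑ j, (∑ i with v i j ≠ u j, w i) * (4 * ‖toLp 2 fun b => y (j, b)‖ ^ 2) := by
        simp only [Finset.sum_filter, Finset.mul_sum, Finset.sum_mul, mul_ite, ite_mul, mul_zero,
          zero_mul]
        exact Finset.sum_comm
    _ ≤ ∑ j, ε * (4 * ‖toLp 2 fun b => y (j, b)‖ ^ 2) := by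
        gcongr with j
        exact h j
    _ = (2 * √ε) ^ 2 * ‖toLp 2 y‖ ^ 2 := by
        rw [norm_toLp_prod_sq, mul_pow, Real.sq_sqrt hε, Finset.mul_sum]
        exact Finset.sum_congr rfl fun j _ => by ring

theorem frequencies_comp_equiv (v : Fin m → Fin n) (σ : Equiv.Perm (Fin m)) :
    frequencies (v ∘ σ) = frequencies v := by
  ext i
  simp only [frequencies, ← Finset.sum_boole, Function.comp_apply]
  rw [Equiv.sum_comp σ fun j => if v j = i then (1 : ℝ) else 0]

theorem card_filter_ne_div [NeZero m] (v : Fin m → Fin n) (i : Fin n) :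
    (Finset.card {j | v j ≠ i} : ℝ) / m = 1 - frequencies v i := by
  have card_add : Finset.card {j | v j = i} + Finset.card {j | v j ≠ i} = m := by
    simpa using Finset.card_filter_add_card_filter_not (s := Finset.univ) (fun j => v j = i)
  have card_add' : (Finset.card {j | v j = i} + Finset.card {j | v j ≠ i} : ℝ) = m :=
    mod_cast card_add
  have hm : (m : ℝ) ≠ 0 := NeZero.ne _
  rw [frequencies, eq_sub_iff_add_eq', ← add_div, card_add', div_self hm]

theorem frequencies_mem_stdSimplex [NeZero m] (v : Fin m → Fin n) :
    frequencies v ∈ stdSimplex ℝ (Fin n) := by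
  refine ⟨fun i => by unfold frequencies; positivity, ?_⟩
  have hm : (m : ℝ) ≠ 0 := NeZero.ne _
  have card_fibers := Finset.card_eq_sum_card_fiberwise (f := v) (s := Finset.univ)
    (t := Finset.univ) fun _ _ => Finset.mem_coe.2 (Finset.mem_univ _)
  simp only [frequencies, ← Finset.sum_div, ← Nat.cast_sum, ← card_fibers, Finset.card_univ,
    Fintype.card_fin, div_self hm]

theorem frequencies_zero [NeZero m] [NeZero n] : frequencies (0 : Fin m → Fin n) = pointMass n := by
  have hm : (m : ℝ) ≠ 0 := NeZero.ne _
  ext i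
  by_cases h : i = 0 <;> simp [frequencies, pointMass, h, hm, Ne.symm]

end RandomStrings

section HellingerDistance

variable {n : ℕ} {p : Fin n → ℝ}

theorem sqrt_sum_sqrt_sub_sqrt_sq (p q : Fin n → ℝ) :
    √(∑ i, (√(p i) - √(q i)) ^ 2) = √2 * hellingerDist p q := by
  rw [hellingerDist, ← Real.sqrt_mul zero_le_two, ← mul_assoc, mul_one_div_cancel two_ne_zero,
    one_mul]

variable [NeZero n]

theorem hellingerDist_pointMass (hp : p ∈ stdSimplex ℝ (Fin n)) :
    hellingerDist p (pointMass n) = √(1 - √(p 0)) := by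
  have sq_sub (i : Fin n) : (√(p i) - √(pointMass n i)) ^ 2 =
      p i + if i = 0 then 1 - 2 * √(p 0) else 0 := by
    rw [sub_sq, Real.sq_sqrt (hp.1 i)]
    by_cases h : i = 0
    · simp only [h, pointMass, Pi.single_eq_same, Real.sqrt_one, if_true]
      ring
    · simp [pointMass, h]
  have sum_sq_sub : ∑ i, (√(p i) - √(pointMass n i)) ^ 2 = 2 * (1 - √(p 0)) := by
    simp only [sq_sub, Finset.sum_add_distrib, hp.2, Finset.sum_ite_eq', Finset.mem_univ, if_true]
    ring
  rw [hellingerDist, sum_sq_sub, ← mul_assoc, one_div_mul_cancel two_ne_zero, one_mul]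

theorem sqrt_half_one_sub_le_hellingerDist_pointMass (hp : p ∈ stdSimplex ℝ (Fin n)) :
    √((1 - p 0) / 2) ≤ hellingerDist p (pointMass n) := by
  rw [hellingerDist_pointMass hp]
  apply Real.sqrt_le_sqrt
  linarith [Real.sq_sqrt (hp.1 0), sq_nonneg (1 - √(p 0))]

theorem hellingerDist_pointMass_le (hp : p ∈ stdSimplex ℝ (Fin n)) :
    hellingerDist p (pointMass n) ≤ √(1 - p 0) := by
  rw [hellingerDist_pointMass hp]
  gcongr
  exact Real.le_sqrt_of_sq_le (pow_le_of_le_one (hp.1 0) (mem_Icc_of_mem_stdSimplex hp 0).2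
    two_ne_zero)

end HellingerDistance

section Entropy

variable {n : ℕ} {p : Fin n → ℝ}

theorem mul_logb_nonpos {b x : ℝ} (hb : 1 < b) (hx₀ : 0 ≤ x) (hx₁ : x ≤ 1) :
    x * Real.logb b x ≤ 0 :=
  mul_nonpos_of_nonneg_of_nonpos hx₀ (Real.logb_nonpos hb hx₀ hx₁)

theorem shannonEntropy_pos (hp : p ∈ stdSimplex ℝ (Fin n)) {i : Fin n} (hi₀ : 0 < p i)
    (hi₁ : p i < 1) : 0 < shannonEntropy p := by
  refine neg_pos.2 (Finset.sum_neg' (fun j _ => ?_) ⟨i, Finset.mem_univ i, ?_⟩)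
  · exact mul_logb_nonpos one_lt_two (hp.1 j) (mem_Icc_of_mem_stdSimplex hp j).2
  · exact mul_neg_of_pos_of_neg hi₀ (Real.logb_neg one_lt_two hi₀ hi₁)

variable [NeZero n]

theorem pointMass_mem_stdSimplex : pointMass n ∈ stdSimplex ℝ (Fin n) :=
  single_mem_stdSimplex ℝ 0

theorem shannonEntropy_pointMass : shannonEntropy (pointMass n) = 0 := by
  rw [shannonEntropy, neg_eq_zero]
  refine Finset.sum_eq_zero fun i _ => ?_
  by_cases h : i = 0 <;> simp [pointMass, h]

end Entropy

section HardDistribution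

variable {n : ℕ} [NeZero n] {ε : ℝ}

theorem sum_eq_add_sub_one_mul {f : Fin n → ℝ} {a : ℝ} (hf : ∀ i ≠ 0, f i = a) :
    ∑ i, f i = f 0 + ((n : ℝ) - 1) * a := by
  rw [← Finset.add_sum_erase _ f (Finset.mem_univ 0),
    Finset.sum_congr rfl fun i hi => hf i (Finset.ne_of_mem_erase hi), Finset.sum_const,
    Finset.card_erase_of_mem (Finset.mem_univ 0), Finset.card_univ, Fintype.card_fin, nsmul_eq_mul,
    Nat.cast_sub NeZero.one_le, Nat.cast_one]

theorem hardDist_zero : hardDist n ε 0 = 1 - ε :=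
  if_pos rfl

theorem hardDist_of_ne_zero {i : Fin n} (hi : i ≠ 0) : hardDist n ε i = ε / ((n : ℝ) - 1) :=
  if_neg hi

theorem hardDist_mem_stdSimplex (hn : 1 < n) (hε₀ : 0 ≤ ε) (hε₁ : ε ≤ 1) :
    hardDist n ε ∈ stdSimplex ℝ (Fin n) := by
  have hn₁ : (0 : ℝ) < n - 1 := sub_pos.2 (mod_cast hn)
  refine ⟨fun i => ?_, ?_⟩
  · unfold hardDist
    split_ifs
    exacts [sub_nonneg.2 hε₁, div_nonneg hε₀ hn₁.le]
  · rw [sum_eq_add_sub_one_mul fun _ => hardDist_of_ne_zero, hardDist_zero,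
      mul_div_cancel₀ _ hn₁.ne', sub_add_cancel]

theorem shannonEntropy_hardDist (hn : 1 < n) :
    shannonEntropy (hardDist n ε) =
      -(1 - ε) * Real.logb 2 (1 - ε) - ε * Real.logb 2 ε + ε * Real.logb 2 ((n : ℝ) - 1) := by
  have hn₁ : (n : ℝ) - 1 ≠ 0 := (sub_pos.2 (mod_cast hn)).ne'
  rw [shannonEntropy, sum_eq_add_sub_one_mul fun i hi => by rw [hardDist_of_ne_zero hi],
    hardDist_zero]
  rcases eq_or_ne ε 0 with rfl | hε
  · simp
  · rw [Real.logb_div hε hn₁]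
    field

theorem mul_logb_le_shannonEntropy_hardDist (hn : 1 < n) (hε₀ : 0 ≤ ε) (hε₁ : ε ≤ 1 / 2) :
    ε * Real.logb 2 n ≤ shannonEntropy (hardDist n ε) := by
  have hn' : (2 : ℝ) ≤ n := mod_cast hn
  have label_zero := mul_logb_nonpos (x := 1 - ε) one_lt_two (by linarith) (by linarith)
  have logb_le : Real.logb 2 n ≤ 1 + Real.logb 2 ((n : ℝ) - 1) := by
    calc Real.logb 2 n ≤ Real.logb 2 (2 * ((n : ℝ) - 1)) :=
          Real.logb_le_logb_of_le one_lt_two (by linarith) (by linarith)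
      _ = 1 + Real.logb 2 ((n : ℝ) - 1) := by
          rw [Real.logb_mul two_ne_zero (by linarith), Real.logb_self_eq_one one_lt_two]
  have mul_logb_le : ε * Real.logb 2 ε ≤ ε * -1 := by
    rcases hε₀.eq_or_lt with rfl | hε
    · simp
    · gcongr
      calc Real.logb 2 ε ≤ Real.logb 2 (1 / 2) := Real.logb_le_logb_of_le one_lt_two hε hε₁
        _ = -1 := by rw [one_div, Real.logb_inv, Real.logb_self_eq_one one_lt_two]
  rw [shannonEntropy_hardDist hn]
  linarith [mul_le_mul_of_nonneg_left logb_le hε₀]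

theorem half_mul_logb_le_shannonEntropy_hardDist (hn : 3 ≤ n) (hε₀ : 0 ≤ ε) (hε₁ : ε ≤ 1) :
    ε / 2 * Real.logb 2 n ≤ shannonEntropy (hardDist n ε) := by
  have hn' : (3 : ℝ) ≤ n := mod_cast hn
  have label_zero := mul_logb_nonpos (x := 1 - ε) one_lt_two (by linarith) (by linarith)
  have labels_ne_zero := mul_logb_nonpos one_lt_two hε₀ hε₁
  have logb_le : Real.logb 2 n ≤ 2 * Real.logb 2 ((n : ℝ) - 1) := by
    calc Real.logb 2 n ≤ Real.logb 2 (((n : ℝ) - 1) ^ 2) :=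
          Real.logb_le_logb_of_le one_lt_two (by linarith) (by nlinarith)
      _ = 2 * Real.logb 2 ((n : ℝ) - 1) := by rw [Real.logb_pow, Nat.cast_ofNat]
  rw [shannonEntropy_hardDist (by omega)]
  linarith [mul_le_mul_of_nonneg_left logb_le hε₀]

theorem shannonEntropy_hardDist_pos (hn : 1 < n) (hε₀ : 0 < ε) (hε₁ : ε < 1) :
    0 < shannonEntropy (hardDist n ε) :=
  shannonEntropy_pos (hardDist_mem_stdSimplex hn hε₀.le hε₁.le) (i := 0)
    (by rwa [hardDist_zero, sub_pos]) (by rwa [hardDist_zero, sub_lt_self_iff])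

theorem hellingerDist_hardDist (hn : 1 < n) (hε₀ : 0 ≤ ε) (hε₁ : ε ≤ 1) :
    hellingerDist (hardDist n ε) (pointMass n) = √(1 - √(1 - ε)) := by
  rw [hellingerDist_pointMass (hardDist_mem_stdSimplex hn hε₀ hε₁), hardDist_zero]

theorem sqrt_half_le_hellingerDist_hardDist (hn : 1 < n) (hε₀ : 0 ≤ ε) (hε₁ : ε ≤ 1) :
    √(ε / 2) ≤ hellingerDist (hardDist n ε) (pointMass n) := by
  simpa [hardDist_zero] using sqrt_half_one_sub_le_hellingerDist_pointMass
    (hardDist_mem_stdSimplex hn hε₀ hε₁)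

theorem hellingerDist_hardDist_le (hn : 1 < n) (hε₀ : 0 ≤ ε) (hε₁ : ε ≤ 1) :
    hellingerDist (hardDist n ε) (pointMass n) ≤ √ε := by
  simpa [hardDist_zero] using hellingerDist_pointMass_le (hardDist_mem_stdSimplex hn hε₀ hε₁)

theorem exists_frequencies_eq_hardDist {m : ℕ} (hn : 1 < n) (hnm : n ≤ m) :
    ∃ v : Fin m → Fin n, frequencies v = hardDist n (((n : ℝ) - 1) / m) := by
  have : NeZero m := ⟨by omega⟩
  have hn₁ : (n : ℝ) - 1 ≠ 0 := (sub_pos.2 (mod_cast hn)).ne'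
  let v : Fin m → Fin n := Function.extend (Fin.castLE hnm) id 0
  have frequencies_of_ne_zero (i : Fin n) (hi : i ≠ 0) : frequencies v i = 1 / m := by
    have preimage : ({j | v j = i} : Finset (Fin m)) = {Fin.castLE hnm i} := by
      ext j
      by_cases hj : ∃ a, Fin.castLE hnm a = j
      · obtain ⟨a, rfl⟩ := hj
        simp [v, (Fin.castLE_injective hnm).extend_apply]
      · simpa [v, Function.extend_apply' _ _ _ hj, hi.symm] using fun h => hj ⟨i, h.symm⟩
    rw [frequencies, preimage, Finset.card_singleton, Nat.cast_one]
  have frequencies_sum : frequencies v 0 + ((n : ℝ) - 1) * (1 / m) = 1 := by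
    rw [← sum_eq_add_sub_one_mul frequencies_of_ne_zero, (frequencies_mem_stdSimplex v).2]
  refine ⟨v, funext fun i => ?_⟩
  rcases eq_or_ne i 0 with rfl | hi
  · rw [hardDist_zero, ← mul_one_div, eq_sub_iff_add_eq, frequencies_sum]
  · rw [frequencies_of_ne_zero i hi, hardDist_of_ne_zero hi, div_div_cancel_left' hn₁, one_div]

end HardDistribution

namespace InputModel

variable {m n : ℕ} {p q : Fin n → ℝ} {s : ℝ} {S S' : Set ℝ}

theorem two_mul_sub_one_le_of_amplitudes {Q : Type} [Fintype Q] [DecidableEq Q] (x₀ : Q)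
    {a b : Q → ℝ} (ha : 0 ≤ a) (hb : 0 ≤ b) (ha' : ∑ x, a x ^ 2 = 1) (hb' : ∑ x, b x ^ 2 = 1)
    {A : QueryAlgorithm Q} (hS : Disjoint S S')
    (hUS : ∀ U ∈ Matrix.unitaryGroup Q ℂ, (∀ x, U x x₀ = a x) → s ≤ A.outputProb U S)
    (hVS : ∀ V ∈ Matrix.unitaryGroup Q ℂ, (∀ x, V x x₀ = b x) → s ≤ A.outputProb V S') :
    2 * s - 1 ≤ 2 * √(∑ x, (a x - b x) ^ 2) * A.queries := by
  obtain ⟨U, hU, V, hV, hUa, hVb, norm_sub_le⟩ :=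
    exists_mem_unitaryGroup_apply_eq_norm_sub_le x₀ ha hb ha' hb'
  exact A.two_mul_sub_one_le_of_meanClose (w := fun _ : Unit => 1) ⟨fun _ => zero_le_one, by simp⟩
    (Real.sqrt_nonneg _) (fun _ => hU) hV (QueryMode.meanClose_of_norm_sub_le norm_sub_le) hS
    (by simpa using hUS U hU hUa) (hVS V hV hVb)

/-- The amplitudes of the purification `∑ᵢ √pᵢ |i⟩|i⟩` of `p`. -/
noncomputable def diagonalAmplitude (p : Fin n → ℝ) (x : Fin n × Fin n) : ℝ :=
  if x.1 = x.2 then √(p x.2) else 0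

theorem sum_diagonalAmplitude_sq (hp : p ∈ stdSimplex ℝ (Fin n)) :
    ∑ x, diagonalAmplitude p x ^ 2 = 1 := by
  simp [diagonalAmplitude, Fintype.sum_prod_type, ite_pow, Real.sq_sqrt (hp.1 _), hp.2]

theorem sum_diagonalAmplitude_sub_sq (p q : Fin n → ℝ) :
    ∑ x, (diagonalAmplitude p x - diagonalAmplitude q x) ^ 2 = ∑ i, (√(p i) - √(q i)) ^ 2 := by
  have sub_eq (x : Fin n × Fin n) : diagonalAmplitude p x - diagonalAmplitude q x =
      if x.1 = x.2 then √(p x.2) - √(q x.2) else 0 := by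
    simp only [diagonalAmplitude, ite_sub_ite, sub_zero]
  simp [sub_eq, Fintype.sum_prod_type, ite_pow]

variable [NeZero n]

theorem two_mul_sub_one_le_of_succeeds_frequency {u : Fin m → Fin n}
    {A : QueryAlgorithm (Fin m × Fin n)} (hS : Disjoint S S')
    (hu : (frequency m).Succeeds A s (frequencies u) S)
    (h₀ : (frequency m).Succeeds A s (pointMass n) S') :
    2 * s - 1 ≤ 4 * √(1 - frequencies u 0) * A.queries := by
  have : NeZero m := ⟨by rintro rfl; exact A.start.1.1.elim0⟩
  have card_mul_inv : (m : ℝ) * (m : ℝ)⁻¹ = 1 := mul_inv_cancel₀ (NeZero.ne _)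
  let shifted (i : Fin m) : Fin m → Fin n := u ∘ Equiv.addRight i
  have prob_shifted_ne (j : Fin m) :
      ∑ i with shifted i j ≠ 0, (m : ℝ)⁻¹ ≤ 1 - frequencies u 0 := by
    rw [Finset.sum_const, nsmul_eq_mul, ← div_eq_mul_inv,
      ← frequencies_comp_equiv u (Equiv.addLeft j), ← card_filter_ne_div]
    rfl
  have s_le : s ≤ ∑ i, (m : ℝ)⁻¹ * A.outputProb (stringOracle (shifted i)) S := by
    calc s = ∑ _i : Fin m, (m : ℝ)⁻¹ * s := by
          simp only [Finset.sum_const, Finset.card_univ, Fintype.card_fin, nsmul_eq_mul,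
            ← mul_assoc, card_mul_inv, one_mul]
      _ ≤ _ := by
          gcongr with i
          exact hu _ (frequencies_comp_equiv u _)
  calc 2 * s - 1 ≤ 2 * (2 * √(1 - frequencies u 0)) * A.queries :=
        A.two_mul_sub_one_le_of_meanClose (w := fun _ : Fin m => (m : ℝ)⁻¹)
          ⟨fun _ => by positivity, by simp⟩ (by positivity)
          (fun _ => stringOracle_mem_unitaryGroup _) (stringOracle_mem_unitaryGroup _)
          (meanClose_stringOracle (fun _ => by positivity)
            (sub_nonneg.2 (mem_Icc_of_mem_stdSimplex (frequencies_mem_stdSimplex u) 0).2)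
            prob_shifted_ne)
          hS s_le (h₀ _ frequencies_zero)
    _ = 4 * √(1 - frequencies u 0) * A.queries := by ring

theorem sum_prod_pointMass_mul (f : (Fin m → Fin n) → ℝ) :
    ∑ v : Fin m → Fin n, (∏ j, pointMass n (v j)) * f v = f 0 := by
  rw [Fintype.sum_eq_single 0]
  · simp [pointMass]
  · intro v hv
    obtain ⟨j, hj⟩ := Function.ne_iff.1 hv
    rw [Finset.prod_eq_zero (Finset.mem_univ j) (Pi.single_eq_of_ne hj _), zero_mul]

theorem two_mul_sub_one_le_of_succeeds_samples {A : QueryAlgorithm (Fin m × Fin n)}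
    (hp : p ∈ stdSimplex ℝ (Fin n)) (hS : Disjoint S S') (hpS : (samples m).Succeeds A s p S)
    (h₀ : (samples m).Succeeds A s (pointMass n) S') :
    2 * s - 1 ≤ 4 * √(1 - p 0) * A.queries := by
  have prob_ne (j : Fin m) : ∑ v : Fin m → Fin n with v j ≠ 0, ∏ k, p (v k) ≤ 1 - p 0 := by
    have sum_erase := Finset.sum_erase_eq_sub (f := p) (Finset.mem_univ 0)
    rw [hp.2] at sum_erase
    rw [← sum_erase, ← sum_filter_prod_apply hp.2 j]
    simp
  calc 2 * s - 1 ≤ 2 * (2 * √(1 - p 0)) * A.queries :=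
        A.two_mul_sub_one_le_of_meanClose (prod_apply_mem_stdSimplex hp) (by positivity)
          (fun v => stringOracle_mem_unitaryGroup v) (stringOracle_mem_unitaryGroup 0)
          (meanClose_stringOracle (prod_apply_mem_stdSimplex hp).1
            (sub_nonneg.2 (mem_Icc_of_mem_stdSimplex hp 0).2) prob_ne)
          hS hpS (h₀.trans_eq (sum_prod_pointMass_mul _))
    _ = 4 * √(1 - p 0) * A.queries := by ring

theorem two_mul_sub_one_le_of_succeeds_quantumSample {A : QueryAlgorithm (Fin n)}
    (hp : p ∈ stdSimplex ℝ (Fin n)) (hq : q ∈ stdSimplex ℝ (Fin n)) (hS : Disjoint S S')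
    (hpS : quantumSample.Succeeds A s p S) (hqS : quantumSample.Succeeds A s q S') :
    2 * s - 1 ≤ 2 * (√2 * hellingerDist p q) * A.queries := by
  have sum_sq {r : Fin n → ℝ} (hr : r ∈ stdSimplex ℝ (Fin n)) : ∑ i, √(r i) ^ 2 = 1 := by
    simp only [Real.sq_sqrt (hr.1 _), hr.2]
  rw [← sqrt_sum_sqrt_sub_sqrt_sq]
  exact two_mul_sub_one_le_of_amplitudes 0 (fun _ => Real.sqrt_nonneg _)
    (fun _ => Real.sqrt_nonneg _) (sum_sq hp) (sum_sq hq) hS (fun U hU hUp => hpS U ⟨hU, hUp⟩)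
    (fun V hV hVq => hqS V ⟨hV, hVq⟩)

theorem isPurifiedOracle_of_apply_eq_diagonalAmplitude
    {U : Matrix (Fin n × Fin n) (Fin n × Fin n) ℂ} (hU : U ∈ Matrix.unitaryGroup (Fin n × Fin n) ℂ)
    (h : ∀ x, U x (0, 0) = diagonalAmplitude p x) : IsPurifiedOracle p U := by
  refine ⟨hU, _, EuclideanSpace.orthonormal_single, fun a i => ?_⟩
  rw [h, diagonalAmplitude]
  by_cases hai : a = i <;> simp [hai]

theorem two_mul_sub_one_le_of_succeeds_purified {A : QueryAlgorithm (Fin n × Fin n)}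
    (hp : p ∈ stdSimplex ℝ (Fin n)) (hq : q ∈ stdSimplex ℝ (Fin n)) (hS : Disjoint S S')
    (hpS : purified.Succeeds A s p S) (hqS : purified.Succeeds A s q S') :
    2 * s - 1 ≤ 2 * (√2 * hellingerDist p q) * A.queries := by
  have nonneg (r : Fin n → ℝ) : 0 ≤ diagonalAmplitude r := fun x => by
    unfold diagonalAmplitude
    positivity
  rw [← sqrt_sum_sqrt_sub_sqrt_sq, ← sum_diagonalAmplitude_sub_sq]
  exact two_mul_sub_one_le_of_amplitudes (0, 0) (nonneg p) (nonneg q) (sum_diagonalAmplitude_sq hp)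
    (sum_diagonalAmplitude_sq hq) hS
    (fun U hU hUp => hpS U (isPurifiedOracle_of_apply_eq_diagonalAmplitude hU hUp))
    (fun V hV hVq => hqS V (isPurifiedOracle_of_apply_eq_diagonalAmplitude hV hVq))

theorem two_mul_sub_one_le_of_succeeds {M : InputModel} (hM : M.Represents p)
    {A : QueryAlgorithm (M.Reg n)} (hp : p ∈ stdSimplex ℝ (Fin n)) (hS : Disjoint S S')
    (hpS : M.Succeeds A s p S) (h₀ : M.Succeeds A s (pointMass n) S') :
    2 * s - 1 ≤ 8 * hellingerDist p (pointMass n) * A.queries := by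
  have dist_nonneg : 0 ≤ hellingerDist p (pointMass n) := Real.sqrt_nonneg _
  have sqrt_two_mul_le :
      √2 * hellingerDist p (pointMass n) ≤ 2 * hellingerDist p (pointMass n) := by
    gcongr
    exact Real.sqrt_le_iff.2 ⟨zero_le_two, by norm_num⟩
  have sqrt_le : √(1 - p 0) ≤ 2 * hellingerDist p (pointMass n) := by
    calc √(1 - p 0) = √2 * √((1 - p 0) / 2) := by
          rw [← Real.sqrt_mul zero_le_two, mul_div_cancel₀ _ two_ne_zero]
      _ ≤ √2 * hellingerDist p (pointMass n) := by
          gcongr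
          exact sqrt_half_one_sub_le_hellingerDist_pointMass hp
      _ ≤ 2 * hellingerDist p (pointMass n) := sqrt_two_mul_le
  have string_le : 4 * √(1 - p 0) * A.queries ≤ 8 * hellingerDist p (pointMass n) * A.queries := by
    gcongr ?_ * _
    linarith
  have unitary_le : 2 * (√2 * hellingerDist p (pointMass n)) * A.queries ≤
      8 * hellingerDist p (pointMass n) * A.queries := by
    gcongr ?_ * _
    linarith
  cases M with
  | frequency m =>
    obtain ⟨u, rfl⟩ := hM
    exact (two_mul_sub_one_le_of_succeeds_frequency hS hpS h₀).trans string_le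
  | samples m => exact (two_mul_sub_one_le_of_succeeds_samples hp hS hpS h₀).trans string_le
  | quantumSample =>
    exact (two_mul_sub_one_le_of_succeeds_quantumSample hp pointMass_mem_stdSimplex hS hpS
      h₀).trans unitary_le
  | purified =>
    exact (two_mul_sub_one_le_of_succeeds_purified hp pointMass_mem_stdSimplex hS hpS
      h₀).trans unitary_le

theorem two_mul_sub_one_le_of_distinguishes {M : InputModel} (hM : M.Represents p)
    {A : QueryAlgorithm (M.Reg n)} (hp : p ∈ stdSimplex ℝ (Fin n))
    (h : M.Distinguishes A s p (pointMass n)) :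
    2 * s - 1 ≤ 8 * hellingerDist p (pointMass n) * A.queries :=
  two_mul_sub_one_le_of_succeeds hM hp (by simp) h.1 h.2

theorem two_mul_sub_one_le_of_estimatesEntropy {M : InputModel} (hM : M.Represents p)
    {A : QueryAlgorithm (M.Reg n)} (hp : p ∈ stdSimplex ℝ (Fin n)) (hp₀ : 0 < shannonEntropy p)
    {γ : ℝ} (hγ : 0 < γ) (h : M.EstimatesEntropy A s γ) :
    2 * s - 1 ≤ 8 * hellingerDist p (pointMass n) * A.queries := by
  have pointMass_estimate := h _ pointMass_mem_stdSimplex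
  rw [shannonEntropy_pointMass, zero_div, mul_zero, Set.Icc_self] at pointMass_estimate
  refine two_mul_sub_one_le_of_succeeds hM hp ?_ (h p hp) pointMass_estimate
  exact Set.disjoint_singleton_right.2 fun zero_mem => (div_pos hp₀ hγ).not_ge zero_mem.1

end InputModel

namespace InputModel

variable {n : ℕ} [NeZero n] {M : InputModel} {A : QueryAlgorithm (M.Reg n)} {s γ ε : ℝ}

theorem div_hellingerDist_le_queries_of_distinguishes (hn : 1 < n) (hε₀ : 0 < ε) (hε₁ : ε ≤ 1)
    (hM : M.Represents (hardDist n ε)) (h : M.Distinguishes A s (hardDist n ε) (pointMass n)) :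
    (2 * s - 1) / 8 / hellingerDist (hardDist n ε) (pointMass n) ≤ A.queries := by
  have dist_pos : 0 < hellingerDist (hardDist n ε) (pointMass n) :=
    (Real.sqrt_pos.2 (half_pos hε₀)).trans_le (sqrt_half_le_hellingerDist_hardDist hn hε₀.le hε₁)
  rw [div_le_iff₀ dist_pos]
  linarith [two_mul_sub_one_le_of_distinguishes hM (hardDist_mem_stdSimplex hn hε₀.le hε₁) h]

theorem div_sqrt_le_queries (hn : 1 < n) (hε₀ : 0 < ε) (hε₁ : ε ≤ 1)
    (h : 2 * s - 1 ≤ 8 * hellingerDist (hardDist n ε) (pointMass n) * A.queries) :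
    (2 * s - 1) / 8 / √ε ≤ A.queries := by
  rw [div_le_iff₀ (Real.sqrt_pos.2 hε₀)]
  have dist_mul_le : hellingerDist (hardDist n ε) (pointMass n) * A.queries ≤ √ε * A.queries := by
    gcongr
    exact hellingerDist_hardDist_le hn hε₀.le hε₁
  linarith

theorem div_sqrt_le_queries_of_distinguishes (hn : 1 < n) (hε₀ : 0 < ε) (hε₁ : ε ≤ 1)
    (hM : M.Represents (hardDist n ε)) (h : M.Distinguishes A s (hardDist n ε) (pointMass n)) :
    (2 * s - 1) / 8 / √ε ≤ A.queries :=
  div_sqrt_le_queries hn hε₀ hε₁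
    (two_mul_sub_one_le_of_distinguishes hM (hardDist_mem_stdSimplex hn hε₀.le hε₁) h)

theorem div_sqrt_le_queries_of_estimatesEntropy (hn : 1 < n) (hε₀ : 0 < ε) (hε₁ : ε < 1)
    (hM : M.Represents (hardDist n ε)) (hγ : 0 < γ) (h : M.EstimatesEntropy A s γ) :
    (2 * s - 1) / 8 / √ε ≤ A.queries :=
  div_sqrt_le_queries hn hε₀ hε₁.le
    (two_mul_sub_one_le_of_estimatesEntropy hM (hardDist_mem_stdSimplex hn hε₀.le hε₁.le)
      (shannonEntropy_hardDist_pos hn hε₀ hε₁) hγ h)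

theorem mul_rpow_le_queries (hn : 1 < n) {k : ℝ} (hk : 0 < k)
    (hM : M.Represents (hardDist n ((n : ℝ) ^ (-k))))
    (h : M.Distinguishes A s (hardDist n ((n : ℝ) ^ (-k))) (pointMass n) ∨
      ∃ γ : ℝ, 0 < γ ∧ M.EstimatesEntropy A s γ) :
    (2 * s - 1) / 8 * (n : ℝ) ^ (k / 2) ≤ A.queries := by
  have hn₀ : (0 : ℝ) < n := mod_cast NeZero.pos n
  have rpow_pos : 0 < (n : ℝ) ^ (-k) := Real.rpow_pos_of_pos hn₀ _
  have rpow_lt_one : (n : ℝ) ^ (-k) < 1 :=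
    Real.rpow_lt_one_of_one_lt_of_neg (mod_cast hn) (neg_lt_zero.2 hk)
  have sqrt_rpow : √((n : ℝ) ^ (-k)) = ((n : ℝ) ^ (k / 2))⁻¹ := by
    rw [Real.sqrt_eq_rpow, ← Real.rpow_mul hn₀.le, ← Real.rpow_neg hn₀.le, mul_one_div, neg_div]
  rw [← div_inv_eq_mul, ← sqrt_rpow]
  rcases h with distinguishes | ⟨γ, hγ, estimates⟩
  · exact div_sqrt_le_queries_of_distinguishes hn rpow_pos rpow_lt_one.le hM distinguishes
  · exact div_sqrt_le_queries_of_estimatesEntropy hn rpow_pos rpow_lt_one hM hγ estimates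

theorem exists_represents_hardDist (hn : 1 < n) {r : ℝ} (hr : 1 ≤ r) (M : InputModel)
    (hM : ∀ m : ℕ, M = .frequency m → r * n ≤ m) :
    ∃ ε : ℝ, 0 < ε ∧ ε ≤ r⁻¹ ∧ M.Represents (hardDist n ε) := by
  have hr₀ : 0 < r := zero_lt_one.trans_le hr
  cases M with
  | frequency m =>
    have hn₁ : (1 : ℝ) < n := mod_cast hn
    have r_mul_le : r * n ≤ m := hM m rfl
    have n_le_m : (n : ℝ) ≤ m := (le_mul_of_one_le_left n.cast_nonneg hr).trans r_mul_le
    have hm : (0 : ℝ) < m := by linarith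
    refine ⟨((n : ℝ) - 1) / m, div_pos (sub_pos.2 hn₁) hm, ?_,
      exists_frequencies_eq_hardDist hn (mod_cast n_le_m)⟩
    rw [div_le_iff₀ hm, ← div_eq_inv_mul, le_div_iff₀ hr₀]
    linarith
  | samples m => exact ⟨r⁻¹, inv_pos.2 hr₀, le_rfl, trivial⟩
  | quantumSample => exact ⟨r⁻¹, inv_pos.2 hr₀, le_rfl, trivial⟩
  | purified => exact ⟨r⁻¹, inv_pos.2 hr₀, le_rfl, trivial⟩

theorem mul_sqrt_le_queries_of_estimatesEntropy (hn : 1 < n) {r : ℝ} (hr : 1 < r)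
    (hM : ∀ m : ℕ, M = .frequency m → r * n ≤ m) (hγ : 0 < γ) (h : M.EstimatesEntropy A s γ) :
    (2 * s - 1) / 8 * √r ≤ A.queries := by
  obtain ⟨ε, hε₀, hεr, represents⟩ := exists_represents_hardDist hn hr.le M hM
  have le_mul_sqrt := (div_le_iff₀ (Real.sqrt_pos.2 hε₀)).1
    (div_sqrt_le_queries_of_estimatesEntropy hn hε₀ (hεr.trans_lt (inv_lt_one_of_one_lt₀ hr))
      represents hγ h)
  rw [← le_div_iff₀ (Real.sqrt_pos.2 (zero_lt_one.trans hr)), div_eq_mul_inv _ √r,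
    ← Real.sqrt_inv]
  exact le_mul_sqrt.trans (by gcongr)

theorem mul_rpow_lt_queries_of_estimatesEntropy (hn : 1 < n) (hs : 1 / 2 < s) {C k : ℝ}
    (hk : 0 < k)
    (hM : ∀ m : ℕ, M = .frequency m →
      ((8 * C / (2 * s - 1)) ^ 2 + 1) * (n : ℝ) ^ (2 * k + 1) ≤ m)
    (hγ : 0 < γ) (h : M.EstimatesEntropy A s γ) : C * (n : ℝ) ^ k < A.queries := by
  set K := (8 * C / (2 * s - 1)) ^ 2 + 1
  have hn₀ : (0 : ℝ) < n := mod_cast NeZero.pos n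
  have hs₀ : 0 < 2 * s - 1 := by linarith
  have C_lt : C < (2 * s - 1) / 8 * √K := by
    have lt_sqrt : 8 * C / (2 * s - 1) < √K := Real.lt_sqrt_of_sq_lt (lt_add_one _)
    rw [div_lt_iff₀ hs₀] at lt_sqrt
    linarith
  have one_lt : 1 < K * (n : ℝ) ^ (2 * k) :=
    one_lt_mul_of_le_of_lt (le_add_of_nonneg_left (sq_nonneg _))
      (Real.one_lt_rpow (mod_cast hn) (by positivity))
  have sqrt_eq : √(K * (n : ℝ) ^ (2 * k)) = √K * (n : ℝ) ^ k := by
    rw [Real.sqrt_mul (by positivity), mul_comm 2 k, Real.rpow_mul hn₀.le, Real.rpow_two,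
      Real.sqrt_sq (by positivity)]
  calc C * (n : ℝ) ^ k < (2 * s - 1) / 8 * √K * (n : ℝ) ^ k := by gcongr
    _ = (2 * s - 1) / 8 * √(K * (n : ℝ) ^ (2 * k)) := by rw [sqrt_eq, mul_assoc]
    _ ≤ A.queries := mul_sqrt_le_queries_of_estimatesEntropy hn one_lt (fun m hm => by
        rw [mul_assoc, ← Real.rpow_add_one hn₀.ne']
        exact hM m hm) hγ h

end InputModel

theorem mainTheorem5 :
    -- the hard pair: its Hellinger distance and its entropies
    (∀ (n : ℕ) [NeZero n], 2 ≤ n → ∀ ε : ℝ, 0 ≤ ε → ε ≤ 1 →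
      hardDist n ε ∈ stdSimplex ℝ (Fin n) ∧ pointMass n ∈ stdSimplex ℝ (Fin n) ∧
      hellingerDist (hardDist n ε) (pointMass n) = √(1 - √(1 - ε)) ∧
      √(ε / 2) ≤ hellingerDist (hardDist n ε) (pointMass n) ∧
      hellingerDist (hardDist n ε) (pointMass n) ≤ √ε ∧
      shannonEntropy (pointMass n) = 0 ∧
      shannonEntropy (hardDist n ε) =
        -(1 - ε) * Real.logb 2 (1 - ε) - ε * Real.logb 2 ε + ε * Real.logb 2 ((n : ℝ) - 1) ∧
      (ε ≤ 1 / 2 → ε * Real.logb 2 n ≤ shannonEntropy (hardDist n ε)) ∧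
      (3 ≤ n → ε / 2 * Real.logb 2 n ≤ shannonEntropy (hardDist n ε))) ∧
    ∀ s : ℝ, 1 / 2 < s →
      (∃ c : ℝ, 0 < c ∧ ∀ (n : ℕ) [NeZero n], 2 ≤ n → ∀ M : InputModel,
        -- every algorithm that distinguishes the pair
        (∀ ε : ℝ, 0 < ε → ε ≤ 1 → M.Represents (hardDist n ε) →
          ∀ A : QueryAlgorithm (M.Reg n), M.Distinguishes A s (hardDist n ε) (pointMass n) →
            c / hellingerDist (hardDist n ε) (pointMass n) ≤ A.queries ∧
            c / √ε ≤ A.queries) ∧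
        -- every algorithm that estimates the entropy of all distributions
        (∀ ε : ℝ, 0 < ε → ε < 1 → M.Represents (hardDist n ε) →
          ∀ γ : ℝ, 1 < γ → ∀ A : QueryAlgorithm (M.Reg n), M.EstimatesEntropy A s γ →
            c / √ε ≤ A.queries) ∧
        -- the choice `ε = n ^ (-k)`
        (∀ k : ℝ, 0 < k → M.Represents (hardDist n ((n : ℝ) ^ (-k))) →
          ∀ A : QueryAlgorithm (M.Reg n),
            (M.Distinguishes A s (hardDist n ((n : ℝ) ^ (-k))) (pointMass n) ∨
              ∃ γ : ℝ, 1 < γ ∧ M.EstimatesEntropy A s γ) →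
            c * (n : ℝ) ^ (k / 2) ≤ A.queries)) ∧
      -- polynomially many queries never suffice (in the frequency model, for long strings)
      ∀ C k : ℝ, 0 < k → ∃ K : ℝ, ∀ (n : ℕ) [NeZero n], 2 ≤ n → ∀ M : InputModel,
        (∀ m : ℕ, M = .frequency m → K * (n : ℝ) ^ (2 * k + 1) ≤ m) →
        ¬ ∃ (γ : ℝ) (A : QueryAlgorithm (M.Reg n)),
          1 < γ ∧ (A.queries : ℝ) ≤ C * (n : ℝ) ^ k ∧ M.EstimatesEntropy A s γ := by
  refine ⟨fun n _ hn ε hε₀ hε₁ => ⟨hardDist_mem_stdSimplex hn hε₀ hε₁, pointMass_mem_stdSimplex,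
    hellingerDist_hardDist hn hε₀ hε₁, sqrt_half_le_hellingerDist_hardDist hn hε₀ hε₁,
    hellingerDist_hardDist_le hn hε₀ hε₁, shannonEntropy_pointMass, shannonEntropy_hardDist hn,
    mul_logb_le_shannonEntropy_hardDist hn hε₀,
    fun hn₃ => half_mul_logb_le_shannonEntropy_hardDist hn₃ hε₀ hε₁⟩,
    fun s hs => ⟨⟨(2 * s - 1) / 8, by linarith, fun n _ hn M => ⟨?_, ?_, ?_⟩⟩,
      fun C k hk => ⟨(8 * C / (2 * s - 1)) ^ 2 + 1, fun n _ hn M hM => ?_⟩⟩⟩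
  · intro ε hε₀ hε₁ hM A h
    exact ⟨InputModel.div_hellingerDist_le_queries_of_distinguishes hn hε₀ hε₁ hM h,
      InputModel.div_sqrt_le_queries_of_distinguishes hn hε₀ hε₁ hM h⟩
  · intro ε hε₀ hε₁ hM γ hγ A h
    exact InputModel.div_sqrt_le_queries_of_estimatesEntropy hn hε₀ hε₁ hM (by linarith) h
  · intro k hk hM A h
    exact InputModel.mul_rpow_le_queries hn hk hM
      (h.imp_right fun ⟨γ, hγ, estimates⟩ => ⟨γ, by linarith, estimates⟩)
  · rintro ⟨γ, A, hγ, queries_le, h⟩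
    exact queries_le.not_gt
      (InputModel.mul_rpow_lt_queries_of_estimatesEntropy hn hs hk hM (by linarith) h)
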